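/- Let $f,g\in\mathbb{R}[X,Y,Z]$ be symmetric homogeneous polynomials of degrees $d,e\ge 1$, and let $C=V(f)$ and $D=V(g)$ be the corresponding real symmetric curves in $\mathbb{P}^2_{\mathbb{C}}$. Assume that $C$ and $D$ are transverse, i.e. that at every point of $V(f,g)=C\cap D\subseteq\mathbb{P}^2_{\mathbb{C}}$ both curves are smooth and their tangent lines are distinct. Call a point of $\mathbb{P}^2_{\mathbb{C}}$ real if it has real homogeneous coordinates. (a) If $de\equiv 3$ or $5 \pmod 6$, then $V(f,g)$ has exactly $3+6k$ real points for some integer $0\le k<de/6$. (b) If $de\equiv 0$ or $2 \pmod 6$, then $V(f,g)$ has exactly $6k$ real points for some integer $0\le k\le de/6$. -/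

import Mathlib

open scoped LinearAlgebra.Projectivization

namespace PlaneCurve

/-- The complex projective plane. -/
abbrev P2 : Type := ℙ ℂ (Fin 3 → ℂ)

/-- The plane curve `V(f)`: the points of the projective plane at all of whose homogeneous
coordinate vectors `f` vanishes (for homogeneous `f`, one coordinate vector suffices, see
`mk_mem_zeroLocus_iff`). -/
def zeroLocus (f : MvPolynomial (Fin 3) ℂ) : Set P2 :=
  {P | ∀ (v : Fin 3 → ℂ) (hv : v ≠ 0), Projectivization.mk ℂ v hv = P → MvPolynomial.eval v f = 0}

theorem eval_smul_of_isHomogeneous {f : MvPolynomial (Fin 3) ℂ} {d : ℕ} (hf : f.IsHomogeneous d)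
    (a : ℂ) (v : Fin 3 → ℂ) :
    MvPolynomial.eval (a • v) f = a ^ d * MvPolynomial.eval v f := by
  rw [MvPolynomial.eval_eq', MvPolynomial.eval_eq', Finset.mul_sum]
  refine Finset.sum_congr rfl fun m hm => ?_
  have hdeg : ∑ i, m i = d := by
    rw [← hf (MvPolynomial.mem_support_iff.1 hm), Finsupp.weight_apply,
      Finsupp.sum_fintype _ _ (by simp)]
    simp
  simp only [Pi.smul_apply, smul_eq_mul, mul_pow, Finset.prod_mul_distrib,
    Finset.prod_pow_eq_pow_sum, hdeg]
  ring

theorem mk_mem_zeroLocus_iff {f : MvPolynomial (Fin 3) ℂ} {d : ℕ} (hf : f.IsHomogeneous d)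
    (v : Fin 3 → ℂ) (hv : v ≠ 0) :
    Projectivization.mk ℂ v hv ∈ zeroLocus f ↔ MvPolynomial.eval v f = 0 := by
  constructor
  · intro h
    exact h v hv rfl
  · intro h w hw hwv
    obtain ⟨a, rfl⟩ := (Projectivization.mk_eq_mk_iff' ℂ w v hw hv).1 hwv
    rw [eval_smul_of_isHomogeneous hf, h, mul_zero]

/-- The locus `V(f, g)`. -/
def interLocus (f g : MvPolynomial (Fin 3) ℂ) : Set P2 := zeroLocus f ∩ zeroLocus g

/-- The vector of partial derivatives of `f` at `v`. Where `f` is homogeneous and vanishes, `V(f)`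
is smooth at `[v]` iff this is nonzero, and then it is the coefficient vector of the tangent line
of `V(f)` at `[v]`. -/
noncomputable def gradAt (f : MvPolynomial (Fin 3) ℂ) (v : Fin 3 → ℂ) : Fin 3 → ℂ :=
  fun i => MvPolynomial.eval v (MvPolynomial.pderiv i f)

/-- `V(f)` and `V(g)` are transverse: at each point of their intersection both are smooth, and
their tangent lines are distinct. -/
def Transverse (f g : MvPolynomial (Fin 3) ℂ) : Prop :=
  ∀ (v : Fin 3 → ℂ) (hv : v ≠ 0), Projectivization.mk ℂ v hv ∈ interLocus f g →
    LinearIndependent ℂ ![gradAt f v, gradAt g v]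

/-- A point of the complex projective plane is real if it has real homogeneous coordinates. -/
def IsRealPoint (P : P2) : Prop :=
  ∃ (v : Fin 3 → ℂ) (hv : v ≠ 0), (∀ i, (v i).im = 0) ∧ Projectivization.mk ℂ v hv = P

/-- A real polynomial, viewed as a complex one. -/
noncomputable def complexify (f : MvPolynomial (Fin 3) ℝ) : MvPolynomial (Fin 3) ℂ :=
  MvPolynomial.map Complex.ofRealHom f

end PlaneCurve

/-!
Since `C` and `D` are invariant under permutation of coordinates, `S₃` acts on the real points of
`C ∩ D`. Transversality constrains this action in two ways.

* On a reflection line `xᵢ = xⱼ` the gradient of a symmetric form is invariant under the swap of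
  `i` and `j`; by Euler's formula it is also orthogonal to the point, which leaves a single
  possible tangent line. So `C ∩ D` has no point with two equal coordinates.
* If `v ∘ s = c • v` for a real `v`, then `c = ±1` because `s` preserves `∑ vᵢ²`. If `c = 1` then
  `s = 1`, as `v` has distinct coordinates. If `c = -1` then `v` is one of the three points
  `[0 : 1 : -1]`, `[-1 : 0 : 1]`, `[1 : -1 : 0]`.

Off these three points the action is therefore free, which gives a multiple of `6` points. The three
points lie on every symmetric curve of odd degree, and a symmetric curve of even degree is singular
at any of them it contains; hence all three count if `de` is odd and none does if `de` is even.

The upper bound is Bézout's inequality, by a dimension count: for coprime `f` and `g` of degrees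
`d` and `e`, the forms `a f + b g` of large degree `m` have codimension `de` in all forms of
degree `m`, and they vanish on `C ∩ D`, while forms of degree `m` take arbitrary values on any set
of at most `m` points.
-/

namespace PlaneCurve

open MvPolynomial Module

section Forms

variable {σ : Type*}

theorem finrank_homogeneousSubmodule [Fintype σ] (R : Type*) [CommRing R] [Nontrivial R] (n : ℕ) :
    finrank R (homogeneousSubmodule σ R n) = (Fintype.card σ).multichoose n := by
  classical
  have degree_eq : {m : σ →₀ ℕ | m.degree = n} =
      ((Finset.univ : Finset σ).finsuppAntidiag n : Set (σ →₀ ℕ)) := by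
    ext m
    simp [Finset.mem_finsuppAntidiag, Finsupp.degree_eq_sum]
  rw [homogeneousSubmodule_eq_finsupp_supported, degree_eq,
    (AddMonoidAlgebra.supportedEquivFinsupp _).finrank_eq, finrank_finsupp_self]
  simp only [Finset.coe_sort_coe, Fintype.card_coe]
  rw [Finset.card_finsuppAntidiag_nat_eq_multichoose, Finset.card_univ]

instance finite_homogeneousSubmodule [Finite σ] (R : Type*) [CommRing R] (n : ℕ) :
    Module.Finite R (homogeneousSubmodule σ R n) :=
  Module.Finite.iff_fg.2 (homogeneousSubmodule_fg σ R n)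

theorem isHomogeneous_of_mul_left {R : Type*} [CommRing R] [IsDomain R] {p q : MvPolynomial σ R}
    {m n : ℕ} (hp : p.IsHomogeneous m) (hp0 : p ≠ 0) (hpq : (p * q).IsHomogeneous (m + n)) :
    q.IsHomogeneous n := by
  classical
  let := gradedAlgebra (σ := σ) (R := R)
  have h := DirectSum.coe_decompose_mul_add_of_left_mem (homogeneousSubmodule σ R) (i := m) (j := n)
    (a := p) (b := q) hp
  rw [DirectSum.decompose_of_mem_same (homogeneousSubmodule σ R) hpq] at h
  rw [mul_left_cancel₀ hp0 h]
  exact (DirectSum.decompose (homogeneousSubmodule σ R) q n).2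

variable {K : Type*} [Field K]

theorem finrank_map_mulLeft {p : MvPolynomial σ K} (hp : p ≠ 0)
    (W : Submodule K (MvPolynomial σ K)) :
    finrank K (W.map (LinearMap.mulLeft K p)) = finrank K W :=
  (W.equivMapOfInjective (LinearMap.mulLeft K p) (mul_right_injective₀ hp)).finrank_eq.symm

theorem map_mulLeft_inf_map_mulLeft {f g : MvPolynomial σ K} {d e : ℕ} (hf : f.IsHomogeneous d)
    (hg : g.IsHomogeneous e) (hg0 : g ≠ 0) (hfg : IsRelPrime f g) (n : ℕ) :
    (homogeneousSubmodule σ K (e + n)).map (LinearMap.mulLeft K f) ⊓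
        (homogeneousSubmodule σ K (d + n)).map (LinearMap.mulLeft K g) =
      (homogeneousSubmodule σ K n).map (LinearMap.mulLeft K (f * g)) := by
  apply le_antisymm
  · rintro _ ⟨⟨a, ha, rfl⟩, ⟨b, -, hab⟩⟩
    obtain ⟨c, rfl⟩ : g ∣ a := hfg.symm.dvd_of_dvd_mul_left ⟨b, hab.symm⟩
    exact ⟨c, isHomogeneous_of_mul_left hg hg0 ha, mul_assoc f g c⟩
  · rintro _ ⟨c, hc, rfl⟩
    exact ⟨⟨g * c, hg.mul hc, (mul_assoc f g c).symm⟩,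
      ⟨f * c, hf.mul hc, show g * (f * c) = f * g * c by ring⟩⟩

theorem finrank_map_mulLeft_sup_map_mulLeft [Finite σ] {f g : MvPolynomial σ K} {d e : ℕ}
    (hf : f.IsHomogeneous d) (hg : g.IsHomogeneous e) (hf0 : f ≠ 0) (hg0 : g ≠ 0)
    (hfg : IsRelPrime f g) (n : ℕ) :
    finrank K ↥((homogeneousSubmodule σ K (e + n)).map (LinearMap.mulLeft K f) ⊔
        (homogeneousSubmodule σ K (d + n)).map (LinearMap.mulLeft K g)) +
      finrank K (homogeneousSubmodule σ K n) =
      finrank K (homogeneousSubmodule σ K (e + n)) +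
        finrank K (homogeneousSubmodule σ K (d + n)) := by
  have finrank_sup_add_finrank_inf := Submodule.finrank_sup_add_finrank_inf_eq
    ((homogeneousSubmodule σ K (e + n)).map (LinearMap.mulLeft K f))
    ((homogeneousSubmodule σ K (d + n)).map (LinearMap.mulLeft K g))
  rwa [map_mulLeft_inf_map_mulLeft hf hg hg0 hfg, finrank_map_mulLeft (mul_ne_zero hf0 hg0),
    finrank_map_mulLeft hf0, finrank_map_mulLeft hg0] at finrank_sup_add_finrank_inf

end Forms

section Interpolation

variable {σ K : Type*} [Field K]

theorem exists_linearForm_separating {P Q : ℙ K (σ → K)} (hPQ : P ≠ Q) :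
    ∃ l : MvPolynomial σ K, l.IsHomogeneous 1 ∧ eval Q.rep l = 0 ∧ eval P.rep l ≠ 0 := by
  obtain ⟨b, hb⟩ := Function.ne_iff.1 Q.rep_nonzero
  have not_proportional : (P.rep b / Q.rep b) • Q.rep ≠ P.rep := fun h => hPQ <| by
    rw [← P.mk_rep, ← Q.mk_rep, Projectivization.mk_eq_mk_iff']
    exact ⟨_, h⟩
  obtain ⟨a, ha⟩ := Function.ne_iff.1 not_proportional
  refine ⟨C (Q.rep b) * X a - C (Q.rep a) * X b,
    (isHomogeneous_C_mul_X _ _).sub (isHomogeneous_C_mul_X _ _), by simp [mul_comm], ?_⟩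
  simp only [Pi.smul_apply, smul_eq_mul, Pi.zero_apply, map_sub, map_mul, eval_C, eval_X] at *
  contrapose! ha
  field_simp
  linear_combination -ha

theorem exists_isHomogeneous_separating {T : Finset (ℙ K (σ → K))} {P : ℙ K (σ → K)} (hP : P ∉ T)
    {m : ℕ} (hm : T.card ≤ m) :
    ∃ p : MvPolynomial σ K, p.IsHomogeneous m ∧ (∀ Q ∈ T, eval Q.rep p = 0) ∧
      eval P.rep p ≠ 0 := by
  have separating_line : ∀ Q : T, ∃ l : MvPolynomial σ K,
      l.IsHomogeneous 1 ∧ eval Q.1.rep l = 0 ∧ eval P.rep l ≠ 0 := fun Q =>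
    exists_linearForm_separating fun h => hP (h ▸ Q.2)
  choose l hl hlQ hlP using separating_line
  obtain ⟨a, ha⟩ := Function.ne_iff.1 P.rep_nonzero
  refine ⟨X a ^ (m - T.card) * ∏ Q : T, l Q, ?_, fun Q hQ => ?_, ?_⟩
  · have := (isHomogeneous_X_pow (R := K) a (m - T.card)).mul
      (IsHomogeneous.prod Finset.univ l (fun _ => 1) fun Q _ => hl Q)
    simpa [Nat.sub_add_cancel hm] using this
  · rw [map_mul, map_prod, Finset.prod_eq_zero (Finset.mem_univ ⟨Q, hQ⟩) (hlQ ⟨Q, hQ⟩), mul_zero]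
  · rw [map_mul, map_pow, map_prod, eval_X]
    exact mul_ne_zero (pow_ne_zero _ ha) (Finset.prod_ne_zero_iff.2 fun Q _ => hlP Q)

theorem exists_isHomogeneous_eval_eq (T : Finset (ℙ K (σ → K))) {m : ℕ} (hm : T.card ≤ m)
    (y : ℙ K (σ → K) → K) :
    ∃ p : MvPolynomial σ K, p.IsHomogeneous m ∧ ∀ Q ∈ T, eval Q.rep p = y Q := by
  classical
  have separating (P : ℙ K (σ → K)) := exists_isHomogeneous_separating (T.notMem_erase P)
    (Finset.card_erase_le.trans hm)
  choose q hq hq_erase hqP using separating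
  refine ⟨∑ P ∈ T, C (y P / eval P.rep (q P)) * q P,
    IsHomogeneous.sum _ _ _ fun P _ => (hq P).C_mul _, fun Q hQ => ?_⟩
  rw [map_sum, Finset.sum_eq_single_of_mem Q hQ fun P _ hPQ => ?_]
  · simp [hqP Q]
  · simp [hq_erase P Q (Finset.mem_erase.2 ⟨hPQ.symm, hQ⟩)]

/-- Evaluation of polynomials at the points of `T`, each represented by the coordinate vector
`Projectivization.rep`. -/
noncomputable def evalAt (T : Finset (ℙ K (σ → K))) : MvPolynomial σ K →ₗ[K] (T → K) :=
  LinearMap.pi fun P => (aeval P.1.rep).toLinearMap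

theorem evalAt_apply (T : Finset (ℙ K (σ → K))) (p : MvPolynomial σ K) (P : T) :
    evalAt T p P = eval P.1.rep p := by
  simp [evalAt]

theorem card_add_finrank_inf_ker_evalAt [Finite σ] (T : Finset (ℙ K (σ → K))) {m : ℕ}
    (hm : T.card ≤ m) :
    T.card + finrank K ↥(homogeneousSubmodule σ K m ⊓ LinearMap.ker (evalAt T)) =
      finrank K (homogeneousSubmodule σ K m) := by
  have surjective : LinearMap.range ((evalAt T).domRestrict (homogeneousSubmodule σ K m)) = ⊤ := by
    rw [LinearMap.range_eq_top]
    intro y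
    obtain ⟨p, hp, hpy⟩ := exists_isHomogeneous_eval_eq T hm (Function.extend Subtype.val y 0)
    refine ⟨⟨p, hp⟩, funext fun P => ?_⟩
    rw [LinearMap.domRestrict_apply, evalAt_apply, hpy P P.2, Subtype.val_injective.extend_apply]
  rw [← LinearMap.finrank_range_add_finrank_ker
    ((evalAt T).domRestrict (homogeneousSubmodule σ K m)), surjective, finrank_top,
    finrank_fintype_fun_eq_card, Fintype.card_coe, LinearMap.ker_domRestrict,
    ← Submodule.finrank_map_subtype_eq, Submodule.map_comap_subtype]

end Interpolation

section Bezout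

theorem two_mul_multichoose_three (n : ℕ) : 2 * Nat.multichoose 3 n = (n + 1) * (n + 2) := by
  induction n with
  | zero => simp
  | succ n ih =>
    rw [Nat.multichoose_succ_succ, Nat.multichoose_two]
    linarith

theorem multichoose_three_add_multichoose_three (a b n : ℕ) :
    Nat.multichoose 3 (a + b + n) + Nat.multichoose 3 n =
      Nat.multichoose 3 (a + n) + Nat.multichoose 3 (b + n) + a * b := by
  linarith [two_mul_multichoose_three (a + b + n), two_mul_multichoose_three n,
    two_mul_multichoose_three (a + n), two_mul_multichoose_three (b + n)]

theorem left_ne_zero_of_isRelPrime_of_eval_eq_zero {σ R : Type*} [CommRing R] [Nontrivial R]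
    {f g : MvPolynomial σ R} (hfg : IsRelPrime f g) {v : σ → R} (hv : eval v g = 0) : f ≠ 0 := by
  rintro rfl
  exact ((isRelPrime_zero_left.1 hfg).map (eval v)).ne_zero hv

theorem card_le_mul_of_isRelPrime {K : Type*} [Field K] {f g : MvPolynomial (Fin 3) K} {d e : ℕ}
    (hf : f.IsHomogeneous d) (hg : g.IsHomogeneous e) (hfg : IsRelPrime f g)
    {T : Finset (ℙ K (Fin 3 → K))} (hTf : ∀ P ∈ T, eval P.rep f = 0)
    (hTg : ∀ P ∈ T, eval P.rep g = 0) : T.card ≤ d * e := by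
  rcases T.eq_empty_or_nonempty with rfl | ⟨P, hP⟩
  · simp
  have hf0 : f ≠ 0 := left_ne_zero_of_isRelPrime_of_eval_eq_zero hfg (hTg P hP)
  have hg0 : g ≠ 0 := left_ne_zero_of_isRelPrime_of_eval_eq_zero hfg.symm (hTf P hP)
  have combinations_vanish :
      (homogeneousSubmodule (Fin 3) K (e + T.card)).map (LinearMap.mulLeft K f) ⊔
        (homogeneousSubmodule (Fin 3) K (d + T.card)).map (LinearMap.mulLeft K g) ≤
      homogeneousSubmodule (Fin 3) K (d + e + T.card) ⊓ LinearMap.ker (evalAt T) := by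
    refine sup_le ?_ ?_
    · rintro _ ⟨p, hp, rfl⟩
      refine ⟨add_assoc d e _ ▸ hf.mul hp, funext fun Q => ?_⟩
      simp [evalAt_apply, hTf Q Q.2]
    · rintro _ ⟨p, hp, rfl⟩
      refine ⟨add_comm e d ▸ add_assoc e d _ ▸ hg.mul hp, funext fun Q => ?_⟩
      simp [evalAt_apply, hTg Q Q.2]
  have rank_le := Submodule.finrank_mono combinations_vanish
  have rank_combinations := finrank_map_mulLeft_sup_map_mulLeft hf hg hf0 hg0 hfg T.card
  have rank_vanishing := card_add_finrank_inf_ker_evalAt T (Nat.le_add_left T.card (d + e))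
  simp only [finrank_homogeneousSubmodule, Fintype.card_fin] at rank_combinations rank_vanishing
  linarith [multichoose_three_add_multichoose_three d e T.card]

theorem exists_ne_zero_eval_eq_zero_of_prime {σ K : Type*} [Finite σ] [Nontrivial σ] [Field K]
    [IsAlgClosed K] {h : MvPolynomial σ K} (hh : Prime h) :
    ∃ v : σ → K, v ≠ 0 ∧ eval v h = 0 := by
  by_contra! no_zero
  have dvd_X : ∀ i, h ∣ X i := by
    intro i
    have : (Ideal.span {h}).IsPrime := (Ideal.span_singleton_prime hh.ne_zero).2 hh
    rw [← Ideal.mem_span_singleton, ← IsPrime.vanishingIdeal_zeroLocus (K := K) (Ideal.span {h}),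
      mem_vanishingIdeal_iff]
    intro x hx
    have hxh : eval x h = 0 := by
      simpa [coe_aeval_eq_eval] using hx h (Ideal.mem_span_singleton_self h)
    have hx0 : x = 0 := not_imp_comm.1 (no_zero x) (not_not_intro hxh)
    simp [hx0]
  have associated_X : ∀ i, Associated h (X i) := fun i =>
    hh.irreducible.associated_of_dvd X_prime.irreducible (dvd_X i)
  obtain ⟨i, j, hij⟩ := exists_pair_ne σ
  have X_dvd : (X i : MvPolynomial σ K) ∣ X j :=
    ((associated_X i).symm.trans (associated_X j)).dvd
  rw [X_dvd_X] at X_dvd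
  simp [hij] at X_dvd

theorem exists_ne_zero_eval_eq_zero_of_not_isUnit {σ K : Type*} [Finite σ] [Nontrivial σ] [Field K]
    [IsAlgClosed K] {h : MvPolynomial σ K} (hh : ¬ IsUnit h) :
    ∃ v : σ → K, v ≠ 0 ∧ eval v h = 0 := by
  by_cases hh0 : h = 0
  · exact ⟨1, one_ne_zero, by simp [hh0]⟩
  obtain ⟨p, hp, q, rfl⟩ := WfDvdMonoid.exists_irreducible_factor hh hh0
  obtain ⟨v, hv, hpv⟩ := exists_ne_zero_eval_eq_zero_of_prime hp.prime
  exact ⟨v, hv, by simp [hpv]⟩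

theorem mk_mem_interLocus_iff {f g : MvPolynomial (Fin 3) ℂ} {d e : ℕ} (hf : f.IsHomogeneous d)
    (hg : g.IsHomogeneous e) (v : Fin 3 → ℂ) (hv : v ≠ 0) :
    Projectivization.mk ℂ v hv ∈ interLocus f g ↔ eval v f = 0 ∧ eval v g = 0 :=
  and_congr (mk_mem_zeroLocus_iff hf v hv) (mk_mem_zeroLocus_iff hg v hv)

theorem gradAt_mul_of_eval_eq_zero {p : MvPolynomial (Fin 3) ℂ} {v : Fin 3 → ℂ}
    (hp : eval v p = 0) (q : MvPolynomial (Fin 3) ℂ) :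
    gradAt (p * q) v = eval v q • gradAt p v := by
  funext i
  simp [gradAt, Derivation.leibniz, hp]

theorem not_linearIndependent_smul_pair {K V : Type*} [Field K] [AddCommGroup V] [Module K V]
    (a b : K) (w : V) : ¬ LinearIndependent K ![a • w, b • w] := by
  simp only [linearIndependent_fin2, Matrix.cons_val_zero, Matrix.cons_val_one]
  rintro ⟨hbw, hab⟩
  exact hab (a / b) (by rw [smul_smul, div_mul_cancel₀ a (left_ne_zero_of_smul hbw)])

variable {f g : MvPolynomial (Fin 3) ℂ} {d e : ℕ}

theorem Transverse.isRelPrime (hf : f.IsHomogeneous d) (hg : g.IsHomogeneous e)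
    (h : Transverse f g) : IsRelPrime f g := by
  rintro p ⟨a, rfl⟩ ⟨b, rfl⟩
  by_contra hp
  obtain ⟨v, hv, hpv⟩ := exists_ne_zero_eval_eq_zero_of_not_isUnit hp
  have hli := h v hv ((mk_mem_interLocus_iff hf hg v hv).2 (by simp [hpv]))
  rw [gradAt_mul_of_eval_eq_zero hpv, gradAt_mul_of_eval_eq_zero hpv] at hli
  exact not_linearIndependent_smul_pair _ _ _ hli

theorem Transverse.encard_interLocus_le (hf : f.IsHomogeneous d) (hg : g.IsHomogeneous e)
    (h : Transverse f g) : (interLocus f g).encard ≤ (d * e : ℕ) := by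
  by_contra! hlt
  obtain ⟨T, hT, hcard⟩ := Set.exists_subset_encard_eq (Order.add_one_le_of_lt hlt)
  lift T to Finset P2 using Set.finite_of_encard_eq_coe (k := d * e + 1) (by simpa using hcard)
  have hle : T.card ≤ d * e := card_le_mul_of_isRelPrime hf hg (h.isRelPrime hf hg)
    (fun P hP => (hT hP).1 P.rep P.rep_nonzero P.mk_rep)
    (fun P hP => (hT hP).2 P.rep P.rep_nonzero P.mk_rep)
  rw [Set.encard_coe_eq_coe_finsetCard] at hcard
  norm_cast at hcard
  omega

end Bezout

section Symmetry

theorem eval_comp_perm {σ R : Type*} [CommSemiring R] {f : MvPolynomial σ R} (hf : f.IsSymmetric)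
    (s : Equiv.Perm σ) (v : σ → R) : eval (v ∘ s) f = eval v f := by
  conv_rhs => rw [← hf s, eval_rename]

variable {f g : MvPolynomial (Fin 3) ℂ} {d e : ℕ}

theorem gradAt_comp_perm (hf : f.IsSymmetric) (s : Equiv.Perm (Fin 3)) (v : Fin 3 → ℂ) :
    gradAt f (v ∘ s) = gradAt f v ∘ s := by
  funext i
  rw [Function.comp_apply, gradAt, gradAt, ← hf s, pderiv_rename s.injective, eval_rename, hf s]

theorem dotProduct_gradAt (hf : f.IsHomogeneous d) (v : Fin 3 → ℂ) :
    v ⬝ᵥ gradAt f v = d * eval v f := by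
  simpa [dotProduct, gradAt] using congrArg (eval v) hf.sum_X_mul_pderiv

/-- The extra factor `c` avoids the exponent `d - 1`, which is truncated at `d = 0`. -/
theorem smul_gradAt_smul (hf : f.IsHomogeneous d) (c : ℂ) (v : Fin 3 → ℂ) :
    c • gradAt f (c • v) = c ^ d • gradAt f v := by
  funext i
  cases d with
  | zero =>
    have constant := totalDegree_eq_zero_iff_eq_C.1 ((totalDegree_zero_iff_isHomogeneous _).2 hf)
    rw [constant]
    simp [gradAt]
  | succ d =>
    simp only [Pi.smul_apply, smul_eq_mul, gradAt]
    rw [eval_smul_of_isHomogeneous hf.pderiv, Nat.add_sub_cancel]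
    ring

theorem gradAt_neg_of_even (hf : f.IsHomogeneous d) (hd : Even d) (v : Fin 3 → ℂ) :
    gradAt f (-v) = -gradAt f v := by
  have h := smul_gradAt_smul hf (-1) v
  rwa [neg_one_smul, neg_one_smul, hd.neg_one_pow, one_smul, neg_eq_iff_eq_neg] at h

theorem eval_eq_zero_of_comp_eq_neg (hf : f.IsHomogeneous d) (hfs : f.IsSymmetric) (hd : Odd d)
    {v : Fin 3 → ℂ} {s : Equiv.Perm (Fin 3)} (hs : v ∘ s = -v) : eval v f = 0 := by
  have eval_neg : eval (-v) f = -eval v f := by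
    simpa [hd.neg_one_pow] using eval_smul_of_isHomogeneous hf (-1) v
  rw [← self_eq_neg, ← eval_neg, ← hs, eval_comp_perm hfs]

theorem not_linearIndependent_of_dotProduct_eq_zero {K : Type*} [Field K] {u w a b : Fin 3 → K}
    (huw : LinearIndependent K ![u, w]) (hua : u ⬝ᵥ a = 0) (hub : u ⬝ᵥ b = 0) (hwa : w ⬝ᵥ a = 0)
    (hwb : w ⬝ᵥ b = 0) : ¬ LinearIndependent K ![a, b] := by
  intro hab
  have mul_eq_zero : Matrix.of ![u, w] * (Matrix.of ![a, b]).transpose = 0 := by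
    ext i j
    fin_cases i <;> fin_cases j <;> assumption
  have rank_add_le := Matrix.rank_add_rank_le_card_of_mul_eq_zero mul_eq_zero
  rw [Matrix.rank_transpose, LinearIndependent.rank_matrix (M := Matrix.of ![u, w]) huw,
    LinearIndependent.rank_matrix (M := Matrix.of ![a, b]) hab] at rank_add_le
  simp at rank_add_le

theorem not_linearIndependent_gradAt_of_eq (hf : f.IsHomogeneous d) (hg : g.IsHomogeneous e)
    (hfs : f.IsSymmetric) (hgs : g.IsSymmetric) {v : Fin 3 → ℂ} (hv : v ≠ 0)
    (hvf : eval v f = 0) (hvg : eval v g = 0) {i j : Fin 3} (hij : i ≠ j) (hvij : v i = v j) :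
    ¬ LinearIndependent ℂ ![gradAt f v, gradAt g v] := by
  have comp_swap : v ∘ Equiv.swap i j = v := by
    rw [Equiv.comp_swap_eq_update, hvij, Function.update_eq_self, ← hvij, Function.update_eq_self]
  have normal_dotProduct_gradAt {p : MvPolynomial (Fin 3) ℂ} (hp : p.IsSymmetric) :
      (Pi.single i 1 - Pi.single j 1) ⬝ᵥ gradAt p v = 0 := by
    have h := congrFun (gradAt_comp_perm hp (Equiv.swap i j) v) i
    rw [comp_swap, Function.comp_apply, Equiv.swap_apply_left] at h
    rw [sub_dotProduct, single_one_dotProduct, single_one_dotProduct, h, sub_self]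
  refine not_linearIndependent_of_dotProduct_eq_zero (u := v) (w := Pi.single i 1 - Pi.single j 1)
    ?_ (by rw [dotProduct_gradAt hf, hvf, mul_zero]) (by rw [dotProduct_gradAt hg, hvg, mul_zero])
    (normal_dotProduct_gradAt hfs) (normal_dotProduct_gradAt hgs)
  rw [LinearIndependent.pair_iff' hv]
  intro a ha
  have hi : a * v i = 1 := by simpa [hij] using congrFun ha i
  have hj : a * v j = -1 := by simpa [hij.symm] using congrFun ha j
  rw [← hvij, hi] at hj
  norm_num at hj

theorem Transverse.injective_of_mem_interLocus (hf : f.IsHomogeneous d) (hg : g.IsHomogeneous e)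
    (hfs : f.IsSymmetric) (hgs : g.IsSymmetric) (h : Transverse f g) {v : Fin 3 → ℂ} (hv : v ≠ 0)
    (hmem : Projectivization.mk ℂ v hv ∈ interLocus f g) : Function.Injective v := by
  obtain ⟨hvf, hvg⟩ := (mk_mem_interLocus_iff hf hg v hv).1 hmem
  intro i j hvij
  by_contra hij
  exact not_linearIndependent_gradAt_of_eq hf hg hfs hgs hv hvf hvg hij hvij (h v hv hmem)

end Symmetry

section AntisymmetricPoints

theorem comp_swap_eq_neg_iff {ι K : Type*} [DecidableEq ι] [Field K] [CharZero K] {i j : ι}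
    {v : ι → K} :
    v ∘ Equiv.swap i j = -v ↔ ∃ a : K, v = a • (Pi.single i 1 - Pi.single j 1) := by
  constructor
  · intro h
    refine ⟨v i, funext fun l => ?_⟩
    have hl : v (Equiv.swap i j l) = -v l := congrFun h l
    rcases eq_or_ne l i with rfl | hli
    · rcases eq_or_ne l j with rfl | hlj
      · simpa [self_eq_neg] using hl
      · simp [hlj]
    · rcases eq_or_ne l j with rfl | hlj
      · rw [Equiv.swap_apply_right] at hl
        simp [hli, hl]
      · rw [Equiv.swap_apply_of_ne_of_ne hli hlj] at hl
        simpa [hli, hlj, self_eq_neg] using hl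
  · rintro ⟨a, rfl⟩
    rw [Pi.smul_comp, ← smul_neg, neg_sub]
    congr 1
    funext l
    simp [Pi.single_apply, Equiv.swap_apply_eq_iff]

/-- The coordinate vector with entries `0`, `1`, `-1` at the indices `k`, `k + 1`, `k + 2`, taken
modulo `3`. -/
def antiVec (k : Fin 3) : Fin 3 → ℂ := Pi.single (k + 1) 1 - Pi.single (k + 2) 1

theorem antiVec_apply_eq_zero_iff {k l : Fin 3} : antiVec k l = 0 ↔ l = k := by
  fin_cases k <;> fin_cases l <;> simp [antiVec]

theorem antiVec_ne_zero (k : Fin 3) : antiVec k ≠ 0 := fun h =>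
  absurd (antiVec_apply_eq_zero_iff.1 (congrFun h (k + 1))) (by simp)

theorem im_antiVec (k l : Fin 3) : (antiVec k l).im = 0 := by
  simp [antiVec, Pi.single_apply, apply_ite Complex.im]

theorem antiVec_comp_swap (k : Fin 3) : antiVec k ∘ Equiv.swap (k + 1) (k + 2) = -antiVec k :=
  comp_swap_eq_neg_iff.2 ⟨1, (one_smul _ _).symm⟩

/-- The points `[0 : 1 : -1]`, `[-1 : 0 : 1]`, `[1 : -1 : 0]`, at which a transposition negates the
homogeneous coordinates. -/
noncomputable def antiPoint (k : Fin 3) : P2 :=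
  Projectivization.mk ℂ (antiVec k) (antiVec_ne_zero k)

theorem antiPoint_injective : Function.Injective antiPoint := by
  intro k l h
  obtain ⟨a, ha⟩ := (Projectivization.mk_eq_mk_iff' ℂ _ _ _ _).1 h
  have hl : antiVec k l = 0 := by
    rw [← ha, Pi.smul_apply, antiVec_apply_eq_zero_iff.2 rfl, smul_zero]
  exact (antiVec_apply_eq_zero_iff.1 hl).symm

theorem isRealPoint_antiPoint (k : Fin 3) : IsRealPoint (antiPoint k) :=
  ⟨antiVec k, antiVec_ne_zero k, im_antiVec k, rfl⟩

theorem mk_mem_range_antiPoint_iff {v : Fin 3 → ℂ} (hv : v ≠ 0) :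
    Projectivization.mk ℂ v hv ∈ Set.range antiPoint ↔ ∃ s : Equiv.Perm (Fin 3), v ∘ s = -v := by
  constructor
  · rintro ⟨k, hk⟩
    obtain ⟨c, rfl⟩ := (Projectivization.mk_eq_mk_iff' ℂ _ _ _ _).1 hk.symm
    exact ⟨Equiv.swap (k + 1) (k + 2), by rw [Pi.smul_comp, antiVec_comp_swap, smul_neg]⟩
  · rintro ⟨s, hs⟩
    have cube_eq_one_or_swap :
        ∀ s : Equiv.Perm (Fin 3), s * s * s = 1 ∨ ∃ k, s = Equiv.swap (k + 1) (k + 2) := by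
      decide
    rcases cube_eq_one_or_swap s with hs3 | ⟨k, rfl⟩
    · refine absurd (self_eq_neg.1 ?_) hv
      calc v = v ∘ ⇑(s * s * s) := by rw [hs3, Equiv.Perm.coe_one, Function.comp_id]
        _ = ((v ∘ s) ∘ s) ∘ s := rfl
        _ = -v := by rw [hs, Pi.neg_comp, hs, neg_neg, hs]
    · obtain ⟨a, rfl⟩ := comp_swap_eq_neg_iff.1 hs
      exact ⟨k, ((Projectivization.mk_eq_mk_iff' ℂ _ _ hv (antiVec_ne_zero k)).2 ⟨a, rfl⟩).symm⟩

theorem dotProduct_self_ne_zero_of_im_eq_zero {ι : Type*} [Fintype ι] {v : ι → ℂ} (hv : v ≠ 0)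
    (hreal : ∀ i, (v i).im = 0) : v ⬝ᵥ v ≠ 0 := by
  have star_eq : star v = v := funext fun i => Complex.conj_eq_iff_im.2 (hreal i)
  intro h
  open scoped ComplexOrder in
  exact hv (dotProduct_star_self_eq_zero.1 (star_eq.symm ▸ h))

theorem gradAt_antiVec_eq_zero {f : MvPolynomial (Fin 3) ℂ} {d : ℕ} (hf : f.IsHomogeneous d)
    (hfs : f.IsSymmetric) (hd : Even d) {k : Fin 3} (hk : eval (antiVec k) f = 0) :
    gradAt f (antiVec k) = 0 := by
  have antisymmetric : gradAt f (antiVec k) ∘ Equiv.swap (k + 1) (k + 2) =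
      -gradAt f (antiVec k) := by
    rw [← gradAt_comp_perm hfs, antiVec_comp_swap, gradAt_neg_of_even hf hd]
  obtain ⟨a, ha : gradAt f (antiVec k) = a • antiVec k⟩ := comp_swap_eq_neg_iff.1 antisymmetric
  have euler : a * (antiVec k ⬝ᵥ antiVec k) = 0 := by
    rw [← smul_eq_mul, ← dotProduct_smul, ← ha, dotProduct_gradAt hf, hk, mul_zero]
  have ha0 : a = 0 := (mul_eq_zero.1 euler).resolve_right
    (dotProduct_self_ne_zero_of_im_eq_zero (antiVec_ne_zero k) (im_antiVec k))
  rw [ha, ha0, zero_smul]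

end AntisymmetricPoints

section Action

theorem comp_perm_ne_zero {ι K : Type*} [Zero K] {v : ι → K} (hv : v ≠ 0) (s : Equiv.Perm ι) :
    v ∘ s ≠ 0 := fun h => hv (s.surjective.injective_comp_right h)

theorem mk_smul_mk {ι K : Type*} [Field K] (s : Equiv.Perm ι) (v : ι → K) (hv : v ≠ 0) :
    DomMulAct.mk s • Projectivization.mk K v hv =
      Projectivization.mk K (v ∘ s) (comp_perm_ne_zero hv s) :=
  Projectivization.smul_mk (DomMulAct.mk s) hv

theorem IsRealPoint.smul (s : (Equiv.Perm (Fin 3))ᵈᵐᵃ) {P : P2} (hP : IsRealPoint P) :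
    IsRealPoint (s • P) := by
  obtain ⟨v, hv, hreal, rfl⟩ := hP
  obtain ⟨s, rfl⟩ := DomMulAct.mk.surjective s
  exact ⟨v ∘ s, comp_perm_ne_zero hv s, fun i => hreal (s i), (mk_smul_mk s v hv).symm⟩

theorem smul_mem_range_antiPoint (s : (Equiv.Perm (Fin 3))ᵈᵐᵃ) {P : P2}
    (hP : P ∈ Set.range antiPoint) : s • P ∈ Set.range antiPoint := by
  induction P using Projectivization.ind with | _ v hv
  obtain ⟨s, rfl⟩ := DomMulAct.mk.surjective s
  obtain ⟨t, ht⟩ := (mk_mem_range_antiPoint_iff hv).1 hP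
  rw [mk_smul_mk, mk_mem_range_antiPoint_iff]
  refine ⟨s⁻¹ * t * s, funext fun l => ?_⟩
  simpa using congrFun ht (s l)

theorem eq_one_or_eq_neg_one_of_comp_perm_eq_smul {ι R : Type*} [Fintype ι] [CommRing R]
    [IsDomain R] {v : ι → R} (hv : v ⬝ᵥ v ≠ 0) {s : Equiv.Perm ι} {c : R} (h : v ∘ s = c • v) :
    c = 1 ∨ c = -1 := by
  rw [← sq_eq_one_iff]
  refine mul_right_cancel₀ hv ?_
  calc c ^ 2 * v ⬝ᵥ v = (v ∘ s) ⬝ᵥ (v ∘ s) := by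
        rw [h, smul_dotProduct, dotProduct_smul, smul_smul, smul_eq_mul, sq]
    _ = 1 * v ⬝ᵥ v := by rw [comp_equiv_dotProduct_comp_equiv, one_mul]

theorem card_dvd_ncard_of_stabilizer_eq_bot {G X : Type*} [Group G] [MulAction G X] {S : Set X}
    (hS : ∀ a : G, ∀ x ∈ S, a • x ∈ S) (hfree : ∀ x ∈ S, MulAction.stabilizer G x = ⊥) :
    Nat.card G ∣ S.ncard := by
  let T : SubMulAction G X := ⟨S, fun a {x} hx => hS a x hx⟩
  have stabilizer_eq_bot (x : T) : MulAction.stabilizer G x = ⊥ := by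
    rw [SubMulAction.stabilizer_of_subMul, hfree x x.2]
  refine ⟨Nat.card (Quotient (MulAction.orbitRel G T)), ?_⟩
  rw [mul_comm, ← Nat.card_prod, ← Nat.card_coe_set_eq S]
  exact Nat.card_congr (MulAction.selfEquivOrbitsQuotientProd (X := T) stabilizer_eq_bot)

end Action

section RealPoints

/-- The real points of `V(f, g)`. -/
def realInterLocus (f g : MvPolynomial (Fin 3) ℂ) : Set P2 :=
  {P ∈ interLocus f g | IsRealPoint P}

variable {f g : MvPolynomial (Fin 3) ℂ} {d e : ℕ}

theorem smul_mem_realInterLocus (hf : f.IsHomogeneous d) (hg : g.IsHomogeneous e)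
    (hfs : f.IsSymmetric) (hgs : g.IsSymmetric) (s : (Equiv.Perm (Fin 3))ᵈᵐᵃ) {P : P2}
    (hP : P ∈ realInterLocus f g) : s • P ∈ realInterLocus f g := by
  refine ⟨?_, hP.2.smul s⟩
  obtain ⟨v, hv, -, rfl⟩ := hP.2
  obtain ⟨s, rfl⟩ := DomMulAct.mk.surjective s
  rw [mk_smul_mk, mk_mem_interLocus_iff hf hg, eval_comp_perm hfs, eval_comp_perm hgs]
  exact (mk_mem_interLocus_iff hf hg v hv).1 hP.1

theorem Transverse.stabilizer_eq_bot (hf : f.IsHomogeneous d) (hg : g.IsHomogeneous e)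
    (hfs : f.IsSymmetric) (hgs : g.IsSymmetric) (h : Transverse f g) {P : P2}
    (hP : P ∈ realInterLocus f g \ Set.range antiPoint) :
    MulAction.stabilizer (Equiv.Perm (Fin 3))ᵈᵐᵃ P = ⊥ := by
  obtain ⟨⟨hmem, v, hv, hreal, rfl⟩, hanti⟩ := hP
  rw [Subgroup.eq_bot_iff_forall]
  intro s hs
  obtain ⟨s, rfl⟩ := DomMulAct.mk.surjective s
  rw [MulAction.mem_stabilizer_iff, mk_smul_mk, Projectivization.mk_eq_mk_iff'] at hs
  obtain ⟨c, hc⟩ := hs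
  rcases eq_one_or_eq_neg_one_of_comp_perm_eq_smul
    (dotProduct_self_ne_zero_of_im_eq_zero hv hreal) hc.symm with rfl | rfl
  · have hinj := h.injective_of_mem_interLocus hf hg hfs hgs hv hmem
    have hs1 : s = 1 := Equiv.ext fun i => hinj (by simpa using (congrFun hc i).symm)
    rw [hs1, DomMulAct.mk_one]
  · rw [neg_one_smul] at hc
    exact absurd ((mk_mem_range_antiPoint_iff hv).2 ⟨s, hc.symm⟩) hanti

theorem Transverse.six_dvd_ncard_realInterLocus_diff (hf : f.IsHomogeneous d)
    (hg : g.IsHomogeneous e) (hfs : f.IsSymmetric) (hgs : g.IsSymmetric) (h : Transverse f g) :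
    6 ∣ (realInterLocus f g \ Set.range antiPoint).ncard := by
  have card_dvd := card_dvd_ncard_of_stabilizer_eq_bot (G := (Equiv.Perm (Fin 3))ᵈᵐᵃ)
    (S := realInterLocus f g \ Set.range antiPoint)
    (fun s P hP => ⟨smul_mem_realInterLocus hf hg hfs hgs s hP.1,
      fun hs => hP.2 (by simpa using smul_mem_range_antiPoint s⁻¹ hs)⟩)
    fun P hP => h.stabilizer_eq_bot hf hg hfs hgs hP
  rwa [← Nat.card_congr (DomMulAct.mk (M := Equiv.Perm (Fin 3))), Nat.card_perm, Nat.card_fin]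
    at card_dvd

theorem antiPoint_mem_realInterLocus (hf : f.IsHomogeneous d) (hg : g.IsHomogeneous e)
    (hfs : f.IsSymmetric) (hgs : g.IsSymmetric) (hde : Odd (d * e)) (k : Fin 3) :
    antiPoint k ∈ realInterLocus f g :=
  ⟨(mk_mem_interLocus_iff hf hg _ _).2
    ⟨eval_eq_zero_of_comp_eq_neg hf hfs (Nat.odd_mul.1 hde).1 (antiVec_comp_swap k),
      eval_eq_zero_of_comp_eq_neg hg hgs (Nat.odd_mul.1 hde).2 (antiVec_comp_swap k)⟩,
    isRealPoint_antiPoint k⟩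

theorem Transverse.antiPoint_notMem_interLocus (hf : f.IsHomogeneous d) (hg : g.IsHomogeneous e)
    (hfs : f.IsSymmetric) (hgs : g.IsSymmetric) (h : Transverse f g) (hde : Even (d * e))
    (k : Fin 3) : antiPoint k ∉ interLocus f g := by
  intro hk
  obtain ⟨hkf, hkg⟩ := (mk_mem_interLocus_iff hf hg _ _).1 hk
  have hli := h _ _ hk
  rcases Nat.even_mul.1 hde with hd | he
  · exact hli.ne_zero 0 (gradAt_antiVec_eq_zero hf hfs hd hkf)
  · exact hli.ne_zero 1 (gradAt_antiVec_eq_zero hg hgs he hkg)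

theorem Transverse.finite_realInterLocus (hf : f.IsHomogeneous d) (hg : g.IsHomogeneous e)
    (h : Transverse f g) : (realInterLocus f g).Finite :=
  (Set.finite_of_encard_le_coe (h.encard_interLocus_le hf hg)).subset fun _ hP => hP.1

theorem Transverse.ncard_realInterLocus_le (hf : f.IsHomogeneous d) (hg : g.IsHomogeneous e)
    (h : Transverse f g) : (realInterLocus f g).ncard ≤ d * e := by
  rw [← Nat.cast_le (α := ℕ∞), (h.finite_realInterLocus hf hg).cast_ncard_eq]
  exact (Set.encard_le_encard fun _ hP => hP.1).trans (h.encard_interLocus_le hf hg)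

theorem Transverse.exists_ncard_realInterLocus_of_odd (hf : f.IsHomogeneous d)
    (hg : g.IsHomogeneous e) (hfs : f.IsSymmetric) (hgs : g.IsSymmetric) (h : Transverse f g)
    (hde : Odd (d * e)) : ∃ k : ℕ, (realInterLocus f g).ncard = 3 + 6 * k := by
  obtain ⟨k, hk⟩ := h.six_dvd_ncard_realInterLocus_diff hf hg hfs hgs
  have range_subset : Set.range antiPoint ⊆ realInterLocus f g :=
    Set.range_subset_iff.2 (antiPoint_mem_realInterLocus hf hg hfs hgs hde)
  refine ⟨k, ?_⟩
  rw [← Set.ncard_sdiff_add_ncard_of_subset range_subset (h.finite_realInterLocus hf hg), hk,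
    Set.ncard_range_of_injective antiPoint_injective, Nat.card_fin, add_comm]

theorem Transverse.six_dvd_ncard_realInterLocus_of_even (hf : f.IsHomogeneous d)
    (hg : g.IsHomogeneous e) (hfs : f.IsSymmetric) (hgs : g.IsSymmetric) (h : Transverse f g)
    (hde : Even (d * e)) : 6 ∣ (realInterLocus f g).ncard := by
  have disjoint : Disjoint (realInterLocus f g) (Set.range antiPoint) := by
    rw [Set.disjoint_right]
    rintro _ ⟨k, rfl⟩ hk
    exact h.antiPoint_notMem_interLocus hf hg hfs hgs hde k hk.1
  simpa only [sdiff_eq_left.2 disjoint] using h.six_dvd_ncard_realInterLocus_diff hf hg hfs hgs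

end RealPoints

end PlaneCurve

theorem mainTheorem3_general (d e : ℕ) (f g : MvPolynomial (Fin 3) ℂ)
    (hf : f.IsHomogeneous d) (hg : g.IsHomogeneous e)
    (hfsymm : f.IsSymmetric) (hgsymm : g.IsSymmetric) (htrans : PlaneCurve.Transverse f g) :
    (Odd (d * e) → ∃ k : ℕ, (k : ℚ) < ((d * e : ℕ) : ℚ) / 6 ∧
      (PlaneCurve.realInterLocus f g).encard = ((3 + 6 * k : ℕ) : ℕ∞)) ∧
    (Even (d * e) → ∃ k : ℕ, (k : ℚ) ≤ ((d * e : ℕ) : ℚ) / 6 ∧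
      (PlaneCurve.realInterLocus f g).encard = ((6 * k : ℕ) : ℕ∞)) := by
  rw [← (htrans.finite_realInterLocus hf hg).cast_ncard_eq]
  have bezout : ((PlaneCurve.realInterLocus f g).ncard : ℚ) ≤ (d * e : ℕ) :=
    Nat.cast_le.2 (htrans.ncard_realInterLocus_le hf hg)
  constructor
  · intro hodd
    obtain ⟨k, hk⟩ := htrans.exists_ncard_realInterLocus_of_odd hf hg hfsymm hgsymm hodd
    refine ⟨k, ?_, congrArg _ hk⟩
    rw [hk, Nat.cast_add, Nat.cast_mul, Nat.cast_ofNat, Nat.cast_ofNat] at bezout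
    linarith
  · intro heven
    obtain ⟨k, hk⟩ := htrans.six_dvd_ncard_realInterLocus_of_even hf hg hfsymm hgsymm heven
    refine ⟨k, ?_, congrArg _ hk⟩
    rw [hk, Nat.cast_mul, Nat.cast_ofNat] at bezout
    linarith

theorem mainTheorem3 (d e : ℕ) (hd : 1 ≤ d) (he : 1 ≤ e)
    (f g : MvPolynomial (Fin 3) ℝ)
    (hf : f.IsHomogeneous d) (hg : g.IsHomogeneous e)
    (hfsymm : f.IsSymmetric) (hgsymm : g.IsSymmetric)
    (htrans : PlaneCurve.Transverse (PlaneCurve.complexify f) (PlaneCurve.complexify g)) :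
    ((d * e ≡ 3 [MOD 6] ∨ d * e ≡ 5 [MOD 6]) →
      ∃ k : ℕ, (k : ℚ) < ((d * e : ℕ) : ℚ) / 6 ∧
        {P ∈ PlaneCurve.interLocus (PlaneCurve.complexify f) (PlaneCurve.complexify g) |
          PlaneCurve.IsRealPoint P}.encard = ((3 + 6 * k : ℕ) : ℕ∞)) ∧
    ((d * e ≡ 0 [MOD 6] ∨ d * e ≡ 2 [MOD 6]) →
      ∃ k : ℕ, (k : ℚ) ≤ ((d * e : ℕ) : ℚ) / 6 ∧
        {P ∈ PlaneCurve.interLocus (PlaneCurve.complexify f) (PlaneCurve.complexify g) |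
          PlaneCurve.IsRealPoint P}.encard = ((6 * k : ℕ) : ℕ∞)) :=
  (mainTheorem3_general d e _ _ (hf.map _) (hg.map _) (hfsymm.map _) (hgsymm.map _) htrans).imp
    (fun h hmod => h (Nat.odd_iff.2 (by unfold Nat.ModEq at hmod; omega)))
    (fun h hmod => h (Nat.even_iff.2 (by unfold Nat.ModEq at hmod; omega)))
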